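/- Let $\mathbb K=\mathbb R$ or $\mathbb C$, and let $\varphi_1(t)=\dfrac{t}{e^t-1}\in\mathbb K[[t]]$. Let $\alpha,\rho\in\mathbb K$, let $\beta(t),\gamma(t)\in\mathbb K[[t]]$, and let $$A(X,Y)=\rho X+\beta(\operatorname{ad}X)(Y)+o(Y),\qquad B(X,Y)=\alpha X+\gamma(\operatorname{ad}X)(Y)+o(Y)$$ be two series of Lie polynomials in $X,Y$ over $\mathbb K$, where each $o(Y)$ denotes a series whose component of every total degree $n$ in $(X,Y)$ is a $\mathbb K$-linear combination of Lie monomials $$\operatorname{ad}_{(\operatorname{ad}X)^{j_1}Y}\circ\cdots\circ\operatorname{ad}_{(\operatorname{ad}X)^{j_{k-1}}Y}\circ(\operatorname{ad}X)^{j_k}(Y),\qquad k\ge 2,\quad j_1,\dots,j_k\ge 0,\quad j_{k-1}<j_k,$$ with $j_1+\cdots+j_k+k=n$. Suppose that $(A,B)$ is a universal solution of the Kashiwara–Vergne equation (1) in the following sense: for every finite-dimensional Lie group $G$ over $\mathbb K$ with Lie algebra $\mathfrak g$, and every open neighbourhood $\mathfrak g_0$ of $0$ in $\mathfrak g$ on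 which $\exp$ is an analytic diffeomorphism onto an open subset of $G$, with inverse $\ln$, there is an open neighbourhood $U$ of $(0,0)$ in $\mathfrak g\times\mathfrak g$ on which the series $A(X,Y)$ and $B(X,Y)$, summed by total degree, converge to analytic $\mathfrak g$-valued functions with $A(0,0)=B(0,0)=0$, and such that for all $(X,Y)\in U$ one has $\exp(Y)\exp(X)\in\exp(\mathfrak g_0)$ and $$\ln(\exp(Y)\exp(X))-X-Y=(\mathrm{id}-e^{-\operatorname{ad}X})A(X,Y)+(e^{\operatorname{ad}Y}-\mathrm{id})B(X,Y).\tag{1}$$ Then, in $\mathbb K[[t]]$, $$\beta(t)=\varphi_1(-t)\left(\frac{\varphi_1(t)-1}{t}+\alpha\right).$$ -/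

import Mathlib

open scoped Manifold ContDiff

universe u

namespace KashiwaraVergne

noncomputable section

/-! ### Formal power series -/

section Series

variable (𝕜 : Type u) [Field 𝕜]

/-- Division by `t` of a power series: `(f(t) - f(0)) / t`. -/
def divT {𝕜 : Type u} [Field 𝕜] (f : PowerSeries 𝕜) : PowerSeries 𝕜 :=
  PowerSeries.mk fun n => PowerSeries.coeff (n + 1) f

theorem divT_mul_X {𝕜 : Type u} [Field 𝕜] (f : PowerSeries 𝕜) :
    divT f * PowerSeries.X = f - PowerSeries.C (PowerSeries.constantCoeff f) := by
  ext n
  cases n with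
  | zero => simp
  | succ n => simp [divT, PowerSeries.coeff_succ_mul_X]

/-- `φ₁(t) = t / (e^t - 1)`, as the inverse of the power series `(e^t - 1) / t`. -/
def phi1 [CharZero 𝕜] : PowerSeries 𝕜 :=
  (divT (PowerSeries.exp 𝕜 - 1))⁻¹

theorem phi1_mul [CharZero 𝕜] :
    phi1 𝕜 * (PowerSeries.exp 𝕜 - 1) = PowerSeries.X := by
  have h := divT_mul_X (PowerSeries.exp 𝕜 - 1)
  have h0 : PowerSeries.constantCoeff (PowerSeries.exp 𝕜 - 1) = 0 := by simp
  rw [h0, map_zero, sub_zero] at h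
  have h1 : PowerSeries.constantCoeff (divT (PowerSeries.exp 𝕜 - 1)) ≠ 0 := by
    simp [divT, ← PowerSeries.coeff_zero_eq_constantCoeff_apply, PowerSeries.coeff_exp,
      PowerSeries.coeff_one]
  have h2 : phi1 𝕜 = (divT (PowerSeries.exp 𝕜 - 1))⁻¹ := rfl
  rw [h2]
  calc (divT (PowerSeries.exp 𝕜 - 1))⁻¹ * (PowerSeries.exp 𝕜 - 1)
      = ((divT (PowerSeries.exp 𝕜 - 1))⁻¹ * divT (PowerSeries.exp 𝕜 - 1)) * PowerSeries.X := by
        rw [mul_assoc, h]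
    _ = PowerSeries.X := by rw [PowerSeries.inv_mul_cancel _ h1, one_mul]

/-- `β_α(t) = φ₁(-t) ((φ₁(t) - 1) / t + α)`. -/
def betaSeries [CharZero 𝕜] (α : 𝕜) : PowerSeries 𝕜 :=
  PowerSeries.rescale (-1) (phi1 𝕜) * (divT (phi1 𝕜 - 1) + PowerSeries.C α)

end Series

/-! ### Series of Lie polynomials in two variables `x`, `y` -/

section LieSeries

variable (𝕜 : Type u) [Field 𝕜]

/-- The free Lie algebra on two generators; its elements are the Lie polynomials. -/
abbrev FreeLie : Type u := FreeLieAlgebra 𝕜 (Fin 2)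

/-- The generator `x`. -/
def genX : FreeLie 𝕜 := FreeLieAlgebra.of 𝕜 0

/-- The generator `y`. -/
def genY : FreeLie 𝕜 := FreeLieAlgebra.of 𝕜 1

/-- `(ad x)^j (y)`. -/
def adXY (j : ℕ) : FreeLie 𝕜 := ((LieAlgebra.ad 𝕜 (FreeLie 𝕜) (genX 𝕜)) ^ j) (genY 𝕜)

/-- For `l = [j₁, …, j_r]`, the Lie monomial
`ad_{(ad x)^{j₁} y} ∘ ⋯ ∘ ad_{(ad x)^{j_r} y} ∘ (ad x)^j (y)`. -/
def lieMonomial (l : List ℕ) (j : ℕ) : FreeLie 𝕜 :=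
  l.foldr (fun i z => ⁅adXY 𝕜 i, z⁆) (adXY 𝕜 j)

/-- The part of total degree `n` of the space of terms `o(Y)`, of degree at least `2` in `y`:
the span of the Lie monomials
`ad_{(ad x)^{j₁} y} ∘ ⋯ ∘ ad_{(ad x)^{j_{k-1}} y} ∘ (ad x)^{j_k} (y)` with `k ≥ 2`,
`j_{k-1} < j_k` and `j₁ + ⋯ + j_k + k = n`; here `l = [j₁, …, j_{k-2}]`, `a = j_{k-1}`,
`b = j_k`. -/
def higherOrder (n : ℕ) : Submodule 𝕜 (FreeLie 𝕜) :=
  Submodule.span 𝕜 {z | ∃ (l : List ℕ) (a b : ℕ),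
    a < b ∧ (l.sum + a + b) + (l.length + 2) = n ∧ z = lieMonomial 𝕜 (l ++ [a]) b}

/-- The series of Lie polynomials `∑ₙ F n`, with `F n` homogeneous of total degree `n`,
is of the form `c x + b(ad x)(y) + o(Y)`. -/
def IsLieSeries {𝕜 : Type u} [Field 𝕜] (F : ℕ → FreeLie 𝕜) (c : 𝕜) (b : PowerSeries 𝕜) : Prop :=
  F 0 = 0 ∧ ∀ n : ℕ,
    F (n + 1) - ((if n = 0 then c • genX 𝕜 else 0) + PowerSeries.coeff n b • adXY 𝕜 n)
      ∈ higherOrder 𝕜 (n + 1)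

/-- The value of a Lie polynomial at a pair of elements `X`, `Y` of a Lie algebra. -/
def evalLie {𝕜 : Type u} [Field 𝕜] {L : Type u} [LieRing L] [LieAlgebra 𝕜 L] (X Y : L)
    (P : FreeLie 𝕜) : L :=
  FreeLieAlgebra.lift 𝕜 ![X, Y] P

end LieSeries

/-! ### Lie groups: Lie algebra, exponential map, logarithm -/

section Group

variable (𝕜 : Type u) [RCLike 𝕜]
  (E : Type u) [NormedAddCommGroup E] [NormedSpace 𝕜 E]
  (G : Type u) [TopologicalSpace G] [ChartedSpace E G] [Group G]

/-- The Lie algebra of the Lie group `G` modelled on `E`, i.e. the tangent space at `1` with the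
bracket of left-invariant vector fields (`GroupLieAlgebra`), as a type of its own. It carries the
norm of the model space `E`, so that one can speak of analytic functions on it. -/
@[nolint unusedArguments]
def LieAlg (𝕜 : Type u) [RCLike 𝕜] (E : Type u) [NormedAddCommGroup E] [NormedSpace 𝕜 E]
    (G : Type u) [TopologicalSpace G] [ChartedSpace E G] [Group G] : Type u := E

instance : NormedAddCommGroup (LieAlg 𝕜 E G) := inferInstanceAs (NormedAddCommGroup E)

instance : NormedSpace 𝕜 (LieAlg 𝕜 E G) := inferInstanceAs (NormedSpace 𝕜 E)

/-- An element of the Lie algebra as a tangent vector at `1`. -/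
def LieAlg.toTangent : LieAlg 𝕜 E G ≃ₗ[𝕜] GroupLieAlgebra 𝓘(𝕜, E) G :=
  LinearEquiv.refl 𝕜 E

variable {𝕜 E G}

instance : Bracket (LieAlg 𝕜 E G) (LieAlg 𝕜 E G) where
  bracket X Y := (LieAlg.toTangent 𝕜 E G).symm
    ⁅LieAlg.toTangent 𝕜 E G X, LieAlg.toTangent 𝕜 E G Y⁆

theorem LieAlg.bracket_def (X Y : LieAlg 𝕜 E G) :
    ⁅X, Y⁆ = (LieAlg.toTangent 𝕜 E G).symm
      ⁅LieAlg.toTangent 𝕜 E G X, LieAlg.toTangent 𝕜 E G Y⁆ := rfl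

instance [FiniteDimensional 𝕜 E] [LieGroup 𝓘(𝕜, E) ω G] : LieRing (LieAlg 𝕜 E G) where
  add_lie X Y Z := by
    have : CompleteSpace E := FiniteDimensional.complete 𝕜 E
    simp only [LieAlg.bracket_def, map_add, add_lie]
  lie_add X Y Z := by
    have : CompleteSpace E := FiniteDimensional.complete 𝕜 E
    simp only [LieAlg.bracket_def, map_add, lie_add]
  lie_self X := by
    have : CompleteSpace E := FiniteDimensional.complete 𝕜 E
    simp only [LieAlg.bracket_def, lie_self, map_zero]
  leibniz_lie X Y Z := by
    have : CompleteSpace E := FiniteDimensional.complete 𝕜 E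
    simp only [LieAlg.bracket_def, LinearEquiv.apply_symm_apply, ← map_add]
    rw [leibniz_lie]

instance [FiniteDimensional 𝕜 E] [LieGroup 𝓘(𝕜, E) ω G] : LieAlgebra 𝕜 (LieAlg 𝕜 E G) where
  lie_smul c X Y := by
    have : CompleteSpace E := FiniteDimensional.complete 𝕜 E
    simp only [LieAlg.bracket_def, map_smul, lie_smul]

/-- `e` is the exponential map of `G`: for every `X` the curve `t ↦ e (t X)` is the integral curve
through `1` of the left-invariant vector field defined by `X`. -/
def IsLieExp (e : LieAlg 𝕜 E G → G) : Prop :=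
  e 0 = 1 ∧ ∀ (X : LieAlg 𝕜 E G) (t : 𝕜),
    HasMFDerivAt 𝓘(𝕜, 𝕜) 𝓘(𝕜, E) (fun s : 𝕜 => e (s • X)) t
      (ContinuousLinearMap.toSpanSingleton 𝕜
        (mulInvariantVectorField (I := 𝓘(𝕜, E)) (LieAlg.toTangent 𝕜 E G X) (e (t • X))))

/-- `φ` is the exponential map of `G` together with an open neighbourhood `φ.source` of `0` on
which it restricts to an analytic diffeomorphism onto the open set `φ.target`. The inverse map
`φ.symm : φ.target → φ.source` is the logarithm. -/
structure IsExpChart (φ : OpenPartialHomeomorph (LieAlg 𝕜 E G) G) : Prop where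
  isLieExp : IsLieExp (φ : LieAlg 𝕜 E G → G)
  zero_mem : (0 : LieAlg 𝕜 E G) ∈ φ.source
  analytic : ContMDiffOn 𝓘(𝕜, LieAlg 𝕜 E G) 𝓘(𝕜, E) ω φ φ.source
  analytic_symm : ContMDiffOn 𝓘(𝕜, E) 𝓘(𝕜, LieAlg 𝕜 E G) ω φ.symm φ.target

variable [FiniteDimensional 𝕜 E] [LieGroup 𝓘(𝕜, E) ω G]

/-- `e^{ad X}(Z)`. -/
def expAd (X Z : LieAlg 𝕜 E G) : LieAlg 𝕜 E G :=
  ∑' n : ℕ, ((n.factorial : 𝕜)⁻¹) • ((LieAlgebra.ad 𝕜 (LieAlg 𝕜 E G) X) ^ n) Z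

/-- `A`, `B` are analytic on the open neighbourhood `U` of `(0, 0)`, vanish at `(0, 0)`, and
satisfy on `U` the equation
`ln (exp Y exp X) - X - Y = (id - e^{-ad X}) A(X, Y) + (e^{ad Y} - id) B(X, Y)`. -/
structure IsSolution (φ : OpenPartialHomeomorph (LieAlg 𝕜 E G) G)
    (U : Set (LieAlg 𝕜 E G × LieAlg 𝕜 E G))
    (A B : LieAlg 𝕜 E G × LieAlg 𝕜 E G → LieAlg 𝕜 E G) : Prop where
  isOpen : IsOpen U
  zero_mem : (0, 0) ∈ U
  analytic_left : AnalyticOnNhd 𝕜 A U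
  analytic_right : AnalyticOnNhd 𝕜 B U
  left_zero : A (0, 0) = 0
  right_zero : B (0, 0) = 0
  mem_target : ∀ X Y, (X, Y) ∈ U → φ Y * φ X ∈ φ.target
  equation : ∀ X Y, (X, Y) ∈ U →
    φ.symm (φ Y * φ X) - X - Y =
      (A (X, Y) - expAd (-X) (A (X, Y))) + (expAd Y (B (X, Y)) - B (X, Y))

end Group

/-- The pair of series of Lie polynomials `∑ₙ FA n`, `∑ₙ FB n` (summed by total degree) is a
universal solution: for every Lie group over `𝕜`, the two series converge near `(0, 0)` to a
solution `(A, B)`. -/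
def IsUniversalSolution {𝕜 : Type u} [RCLike 𝕜] (FA FB : ℕ → FreeLie 𝕜) : Prop :=
  ∀ (E : Type u) [NormedAddCommGroup E] [NormedSpace 𝕜 E] [FiniteDimensional 𝕜 E]
    (G : Type u) [TopologicalSpace G] [ChartedSpace E G] [Group G] [LieGroup 𝓘(𝕜, E) ω G]
    (φ : OpenPartialHomeomorph (LieAlg 𝕜 E G) G), IsExpChart φ →
    ∃ (U : Set (LieAlg 𝕜 E G × LieAlg 𝕜 E G))
      (A B : LieAlg 𝕜 E G × LieAlg 𝕜 E G → LieAlg 𝕜 E G),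
      IsSolution φ U A B ∧
      ∀ X Y, (X, Y) ∈ U →
        HasSum (fun n => evalLie X Y (FA n)) (A (X, Y)) ∧
        HasSum (fun n => evalLie X Y (FB n)) (B (X, Y))

end

end KashiwaraVergne

/-!
The universal equation is tested on a single Lie group: the plane `𝕜 × 𝕜` with the product
`(a, b) (a', b') = (a + a', b + e^a b')`, a covering of the identity component of the group of
affine transformations of the line (for `𝕜 = ℝ`, that component itself).

Its Lie algebra has a basis `h`, `e` with `[h, e] = e` (`AffineCover.bracket_ofProd`). At the pair
`X = t h`, `Y = s e` one has `(ad X)^j Y = t^j s e`; these vectors commute with each other, so every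
Lie monomial of degree at least `2` in `Y` vanishes and only the part of `A` and `B` of degree at
most one in `Y` survives: `A = ρ t h + β(t) s e` and `B = α t h + γ(t) s e`
(`IsLieSeries.hasSum_evalLie`).

The exponential map is `exp (t h + s e) = (t, s (e^t - 1) / t)`, so that
`ln (exp Y exp X) = t h + s t / (e^t - 1) e` (`AffineCover.expChart_symm_mul`). The `e`-component of
the equation, divided by `s`, therefore reads `φ₁(t) - 1 = (1 - e^{-t}) β(t) - α t` for all small
`t`; the term with `γ` disappears because `(ad Y) e = 0`. A convergent power series is determined by
its sum (`ConvergesTo.unique`), so this is an identity of formal power series, which is solved for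
`β` in `eq_betaSeries`.
-/

namespace KashiwaraVergne

noncomputable section

/-! ### Formal power series -/

section PowerSeriesIdentity

variable {𝕜 : Type u} [Field 𝕜] [CharZero 𝕜]

theorem divT_phi1_sub_one_mul_X : divT (phi1 𝕜 - 1) * PowerSeries.X = phi1 𝕜 - 1 := by
  have h : PowerSeries.constantCoeff (phi1 𝕜) = 1 := by
    have h0 : PowerSeries.constantCoeff (divT (PowerSeries.exp 𝕜 - 1)) = 1 := by
      simp only [divT, ← PowerSeries.coeff_zero_eq_constantCoeff_apply, PowerSeries.coeff_mk]
      simp [PowerSeries.coeff_exp, PowerSeries.coeff_one]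
    rw [phi1, PowerSeries.constantCoeff_inv, h0, inv_one]
  rw [divT_mul_X]
  simp [h]

/-- The hypothesis is `(1 - e^{-t}) β(t) = φ₁(t) - 1 + α t`, multiplied by `e^t - 1 = t / φ₁(t)` to
clear the denominator of `φ₁`. -/
theorem eq_betaSeries {α : 𝕜} {β : PowerSeries 𝕜}
    (h : (1 - PowerSeries.rescale (-1) (PowerSeries.exp 𝕜)) * β * (PowerSeries.exp 𝕜 - 1) =
      PowerSeries.C α * PowerSeries.X * (PowerSeries.exp 𝕜 - 1) + PowerSeries.X
        - (PowerSeries.exp 𝕜 - 1)) :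
    β = betaSeries 𝕜 α := by
  have h1 := phi1_mul 𝕜
  have h2 := congrArg (PowerSeries.rescale (-1 : 𝕜)) h1
  rw [map_mul, map_sub, map_one, PowerSeries.rescale_X, map_neg, map_one] at h2
  have h3 := divT_phi1_sub_one_mul_X (𝕜 := 𝕜)
  unfold betaSeries
  -- One factor `t` clears `(φ₁(t) - 1) / t`, the other comes from multiplying `h` by `φ₁(t)`.
  have hX : (PowerSeries.X : PowerSeries 𝕜) ^ 2 ≠ 0 := pow_ne_zero _ PowerSeries.X_ne_zero
  apply mul_right_cancel₀ hX
  generalize PowerSeries.rescale (-1) (phi1 𝕜) = q at *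
  generalize PowerSeries.rescale (-1) (PowerSeries.exp 𝕜) = e at *
  generalize PowerSeries.exp 𝕜 = E at *
  generalize phi1 𝕜 = p at *
  generalize divT (p - 1) = d at *
  generalize PowerSeries.C α = a at *
  generalize (PowerSeries.X : PowerSeries 𝕜) = x at *
  linear_combination (p * q) * h - (β * q * (1 - e)) * h1 + (β * x) * h2 + (a * x * q - q) * h1
    - q * x * h3

end PowerSeriesIdentity

/-! ### Convergent power series -/

section Convergence

variable {𝕜 : Type u} [RCLike 𝕜]

/-- The power series `p` converges to the function `f` on a neighbourhood of `0`. -/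
def ConvergesTo (p : PowerSeries 𝕜) (f : 𝕜 → 𝕜) : Prop :=
  ∀ᶠ t in nhds (0 : 𝕜), HasSum (fun n => PowerSeries.coeff n p * t ^ n) (f t)

namespace ConvergesTo

variable {p q : PowerSeries 𝕜} {f g : 𝕜 → 𝕜}

theorem add (hp : ConvergesTo p f) (hq : ConvergesTo q g) :
    ConvergesTo (p + q) (fun t => f t + g t) := by
  filter_upwards [hp, hq] with t h1 h2
  simpa [add_mul] using h1.add h2

theorem sub (hp : ConvergesTo p f) (hq : ConvergesTo q g) :
    ConvergesTo (p - q) (fun t => f t - g t) := by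
  filter_upwards [hp, hq] with t h1 h2
  simpa [sub_mul] using h1.sub h2

theorem mul (hp : ConvergesTo p f) (hq : ConvergesTo q g) :
    ConvergesTo (p * q) (fun t => f t * g t) := by
  filter_upwards [hp, hq] with t h1 h2
  have n1 := h1.summable.norm
  have n2 := h2.summable.norm
  have h : (fun n => PowerSeries.coeff n (p * q) * t ^ n) = fun n =>
      ∑ kl ∈ Finset.HasAntidiagonal.antidiagonal n,
        (PowerSeries.coeff kl.1 p * t ^ kl.1) * (PowerSeries.coeff kl.2 q * t ^ kl.2) := by
    ext n
    rw [PowerSeries.coeff_mul, Finset.sum_mul]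
    refine Finset.sum_congr rfl fun kl hkl => ?_
    rw [← Finset.HasAntidiagonal.mem_antidiagonal.mp hkl, pow_add]
    ring
  rw [h, ← h1.tsum_eq, ← h2.tsum_eq,
    tsum_mul_tsum_eq_tsum_sum_antidiagonal_of_summable_norm n1 n2]
  exact (summable_norm_sum_mul_antidiagonal_of_summable_norm n1 n2).of_norm.hasSum

theorem const (a : 𝕜) : ConvergesTo (PowerSeries.C a) (fun _ => a) := by
  refine Filter.Eventually.of_forall fun t => ?_
  convert hasSum_single (f := fun n => PowerSeries.coeff n (PowerSeries.C a) * t ^ n) 0 ?_ using 1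
  · simp
  · intro n hn
    simp [PowerSeries.coeff_C, hn]

theorem one : ConvergesTo (1 : PowerSeries 𝕜) (fun _ => 1) := by
  simpa using const (1 : 𝕜)

theorem X : ConvergesTo (PowerSeries.X : PowerSeries 𝕜) (fun t => t) := by
  refine Filter.Eventually.of_forall fun t => ?_
  convert hasSum_single (f := fun n => PowerSeries.coeff n (PowerSeries.X) * t ^ n) 1 ?_ using 1
  · simp
  · intro n hn
    simp [PowerSeries.coeff_X, hn]

theorem exp : ConvergesTo (PowerSeries.exp 𝕜) NormedSpace.exp := by
  refine Filter.Eventually.of_forall fun t => ?_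
  convert NormedSpace.exp_series_hasSum_exp' (𝕂 := 𝕜) t using 2 with n
  simp [PowerSeries.coeff_exp]

theorem rescale (hp : ConvergesTo p f) (a : 𝕜) :
    ConvergesTo (PowerSeries.rescale a p) (fun t => f (a * t)) := by
  have h : Filter.Tendsto (fun t : 𝕜 => a * t) (nhds 0) (nhds 0) := by
    have : Continuous fun t : 𝕜 => a * t := by fun_prop
    simpa using this.tendsto 0
  filter_upwards [h.eventually hp] with t ht
  convert ht using 2 with n
  rw [PowerSeries.coeff_rescale, mul_pow]
  ring

theorem unique (hp : ConvergesTo p f) (hq : ConvergesTo q g) (hfg : f =ᶠ[nhds 0] g) : p = q := by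
  have key : ∀ {p : PowerSeries 𝕜} {f : 𝕜 → 𝕜}, ConvergesTo p f → HasFPowerSeriesAt f
      (FormalMultilinearSeries.ofScalars 𝕜 (fun n => PowerSeries.coeff n p)) 0 := by
    intro p f hp
    rw [hasFPowerSeriesAt_iff]
    filter_upwards [hp] with t ht
    simpa [FormalMultilinearSeries.coeff_ofScalars, mul_comm] using ht
  have h := ((key hp).congr hfg).eq_formalMultilinearSeries (key hq)
  ext n
  have := congrArg (fun s => FormalMultilinearSeries.coeff s n) h
  simpa [FormalMultilinearSeries.coeff_ofScalars] using this

end ConvergesTo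

/-! ### The function `(e^t - 1) / t` -/

/-- The entire function `(e^t - 1) / t`, extended by its limit `1` at `0`. -/
def expQuot (t : 𝕜) : 𝕜 := dslope NormedSpace.exp 0 t

theorem expQuot_zero : expQuot (0 : 𝕜) = 1 := by
  simp [expQuot, dslope_same, (hasDerivAt_exp_zero (𝕂 := 𝕜)).deriv]

theorem mul_expQuot (t : 𝕜) : t * expQuot t = NormedSpace.exp t - 1 := by
  have := sub_smul_dslope (NormedSpace.exp : 𝕜 → 𝕜) 0 t
  simpa [expQuot] using this

theorem analyticAt_exp (t : 𝕜) : AnalyticAt 𝕜 (NormedSpace.exp : 𝕜 → 𝕜) t :=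
  NormedSpace.exp_analytic t

theorem contDiff_exp : ContDiff 𝕜 ω (NormedSpace.exp : 𝕜 → 𝕜) :=
  contDiff_iff_contDiffAt.mpr fun t => (analyticAt_exp t).contDiffAt

theorem contDiff_expQuot : ContDiff 𝕜 ω (expQuot : 𝕜 → 𝕜) := by
  refine contDiff_iff_contDiffAt.mpr fun t => AnalyticAt.contDiffAt ?_
  rcases eq_or_ne t 0 with rfl | ht
  · obtain ⟨p, hp⟩ := analyticAt_exp (0 : 𝕜)
    exact ⟨_, hp.has_fpower_series_dslope_fslope⟩
  · have h : AnalyticAt 𝕜 (fun s : 𝕜 => (NormedSpace.exp s - 1) / s) t :=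
      ((analyticAt_exp t).sub analyticAt_const).div analyticAt_id ht
    refine h.congr ?_
    filter_upwards [isOpen_ne.mem_nhds ht] with s hs
    rw [← mul_expQuot, mul_div_cancel_left₀ _ hs]

/-- Up to the constant `x₂`, the `e`-component of the curve `s ↦ exp (s (a h + x₂ e))`. -/
theorem hasDerivAt_mul_expQuot_mul (a t : 𝕜) :
    HasDerivAt (fun s : 𝕜 => s * expQuot (s * a)) (NormedSpace.exp (t * a)) t := by
  rcases eq_or_ne a 0 with rfl | ha
  · simpa [expQuot_zero] using hasDerivAt_id' t
  · have h : (fun s : 𝕜 => s * expQuot (s * a)) = fun s => (NormedSpace.exp (s * a) - 1) / a := by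
      ext s
      rw [← mul_expQuot]
      field_simp
    rw [h]
    have h1 : HasDerivAt (fun s : 𝕜 => s * a) a t := by simpa using (hasDerivAt_id t).mul_const a
    have h2 := ((HasDerivAt.comp t (hasDerivAt_exp (x := t * a)) h1).sub_const 1).div_const a
    rwa [mul_div_cancel_right₀ _ ha] at h2

end Convergence

/-! ### The affine group, its Lie algebra and its exponential map -/

/-- The plane `𝕜 × 𝕜` with the group law `(a, b) (a', b') = (a + a', b + e^a b')`, where `(a, b)`
acts on the line by `x ↦ e^a x + b`. The first coordinate is the logarithm of the linear part, so
the group is covered by one chart over `ℂ` as well as over `ℝ`. It is a type of its own because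
`𝕜 × 𝕜` carries the componentwise multiplication. -/
def AffineCover (𝕜 : Type u) : Type u := 𝕜 × 𝕜

namespace AffineCover

variable {𝕜 : Type u} [RCLike 𝕜]

instance : TopologicalSpace (AffineCover 𝕜) := inferInstanceAs (TopologicalSpace (𝕜 × 𝕜))

instance : ChartedSpace (𝕜 × 𝕜) (AffineCover 𝕜) :=
  inferInstanceAs (ChartedSpace (𝕜 × 𝕜) (𝕜 × 𝕜))

theorem exp_add (a b : 𝕜) :
    NormedSpace.exp (a + b) = NormedSpace.exp a * NormedSpace.exp b :=
  NormedSpace.exp_add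

instance : Group (AffineCover 𝕜) where
  mul g h := (g.1 + h.1, g.2 + NormedSpace.exp g.1 * h.2)
  one := (0, 0)
  inv g := (-g.1, -(NormedSpace.exp (-g.1) * g.2))
  mul_assoc g h k := by
    refine Prod.ext (add_assoc _ _ _) ?_
    change (g.2 + NormedSpace.exp g.1 * h.2) + NormedSpace.exp (g.1 + h.1) * k.2 =
      g.2 + NormedSpace.exp g.1 * (h.2 + NormedSpace.exp h.1 * k.2)
    rw [exp_add]
    ring
  one_mul g := by
    refine Prod.ext (zero_add _) ?_
    change 0 + NormedSpace.exp 0 * g.2 = g.2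
    simp
  mul_one g := by
    refine Prod.ext (add_zero _) ?_
    change g.2 + NormedSpace.exp g.1 * 0 = g.2
    simp
  inv_mul_cancel g := by
    refine Prod.ext (neg_add_cancel _) ?_
    change -(NormedSpace.exp (-g.1) * g.2) + NormedSpace.exp (-g.1) * g.2 = 0
    simp

theorem mul_def (g h : AffineCover 𝕜) :
    g * h = ((g.1 + h.1, g.2 + NormedSpace.exp g.1 * h.2) : 𝕜 × 𝕜) := rfl

instance : LieGroup 𝓘(𝕜, 𝕜 × 𝕜) ω (AffineCover 𝕜) where
  toIsManifold := inferInstanceAs (IsManifold 𝓘(𝕜, 𝕜 × 𝕜) ω (𝕜 × 𝕜))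
  contMDiff_mul := by
    have h : ContDiff 𝕜 ω fun p : (𝕜 × 𝕜) × (𝕜 × 𝕜) =>
        (p.1.1 + p.2.1, p.1.2 + NormedSpace.exp p.1.1 * p.2.2) := by
      have := contDiff_exp (𝕜 := 𝕜)
      fun_prop
    have h' := h.contMDiff
    rw [modelWithCornersSelf_prod, ← chartedSpaceSelf_prod] at h'
    exact h'
  contMDiff_inv := by
    have h : ContDiff 𝕜 ω fun p : 𝕜 × 𝕜 => (-p.1, -(NormedSpace.exp (-p.1) * p.2)) := by
      have := contDiff_exp (𝕜 := 𝕜)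
      fun_prop
    exact h.contMDiff

theorem mulInvariantVectorField_eq (v : 𝕜 × 𝕜) (g : AffineCover 𝕜) :
    mulInvariantVectorField (I := 𝓘(𝕜, 𝕜 × 𝕜)) (G := AffineCover 𝕜) v g =
      ((v.1, NormedSpace.exp g.1 * v.2) : 𝕜 × 𝕜) := by
  have h : HasFDerivAt (fun p : 𝕜 × 𝕜 => (g.1 + p.1, g.2 + NormedSpace.exp g.1 * p.2))
      ((ContinuousLinearMap.fst 𝕜 𝕜 𝕜).prod
        (NormedSpace.exp g.1 • ContinuousLinearMap.snd 𝕜 𝕜 𝕜)) (0, 0) :=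
    (hasFDerivAt_fst.const_add _).prodMk ((hasFDerivAt_snd.const_mul _).const_add _)
  have h' : mfderiv 𝓘(𝕜, 𝕜 × 𝕜) 𝓘(𝕜, 𝕜 × 𝕜) (fun p : AffineCover 𝕜 => g * p) 1 = _ :=
    h.hasMFDerivAt.mfderiv
  unfold mulInvariantVectorField
  rw [h']
  rfl

/-- The bracket at `0` of the vector fields `p ↦ (v₁, e^{p₁} v₂)`, which are the left-invariant
fields of `AffineCover`. -/
theorem lieBracket_eq (x y : 𝕜 × 𝕜) :
    VectorField.lieBracket 𝕜 (fun p : 𝕜 × 𝕜 => (x.1, NormedSpace.exp p.1 * x.2))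
      (fun p : 𝕜 × 𝕜 => (y.1, NormedSpace.exp p.1 * y.2)) (0, 0) =
        (0, x.1 * y.2 - y.1 * x.2) := by
  have key : ∀ v : 𝕜 × 𝕜, HasFDerivAt (fun p : 𝕜 × 𝕜 => (v.1, NormedSpace.exp p.1 * v.2))
      ((0 : 𝕜 × 𝕜 →L[𝕜] 𝕜).prod (v.2 • ContinuousLinearMap.fst 𝕜 𝕜 𝕜)) (0, 0) := by
    intro v
    refine (hasFDerivAt_const _ _).prodMk ?_
    have h1 : HasDerivAt (NormedSpace.exp : 𝕜 → 𝕜) 1 (0 : 𝕜) := hasDerivAt_exp_zero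
    have h2 : HasFDerivAt (Prod.fst : 𝕜 × 𝕜 → 𝕜) (ContinuousLinearMap.fst 𝕜 𝕜 𝕜) (0, 0) :=
      hasFDerivAt_fst
    simpa using (h1.comp_hasFDerivAt ((0, 0) : 𝕜 × 𝕜) h2).mul_const v.2
  simp only [VectorField.lieBracket]
  rw [(key x).fderiv, (key y).fderiv]
  ext <;> simp
  ring

/-- Coordinates on the Lie algebra of `AffineCover`: `(x₁, x₂)` stands for `x₁ h + x₂ e`. -/
def ofProd : (𝕜 × 𝕜) ≃L[𝕜] LieAlg 𝕜 (𝕜 × 𝕜) (AffineCover 𝕜) :=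
  { toFun := fun x => x
    invFun := fun x => x
    left_inv := fun _ => rfl
    right_inv := fun _ => rfl
    map_add' := fun _ _ => rfl
    map_smul' := fun _ _ => rfl
    continuous_toFun := continuous_id
    continuous_invFun := continuous_id }

theorem bracket_ofProd (x y : 𝕜 × 𝕜) :
    ⁅ofProd x, ofProd y⁆ = ofProd (0, x.1 * y.2 - y.1 * x.2) := by
  have h : ∀ V W : (p : 𝕜 × 𝕜) → TangentSpace 𝓘(𝕜, 𝕜 × 𝕜) p,
      VectorField.mlieBracket 𝓘(𝕜, 𝕜 × 𝕜) V W (0, 0) =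
        VectorField.lieBracket 𝕜 V W (0, 0) := by
    intro V W
    rw [← VectorField.mlieBracketWithin_univ, VectorField.mlieBracketWithin_eq_lieBracketWithin]
    exact congrFun (VectorField.lieBracketWithin_univ (E := 𝕜 × 𝕜)) _
  have key : ∀ v : 𝕜 × 𝕜,
      mulInvariantVectorField (I := 𝓘(𝕜, 𝕜 × 𝕜)) (G := AffineCover 𝕜) v =
        fun p : 𝕜 × 𝕜 => (v.1, NormedSpace.exp p.1 * v.2) :=
    fun v => funext fun g => mulInvariantVectorField_eq v g
  change VectorField.mlieBracket 𝓘(𝕜, 𝕜 × 𝕜)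
    (mulInvariantVectorField (I := 𝓘(𝕜, 𝕜 × 𝕜)) (G := AffineCover 𝕜) x)
    (mulInvariantVectorField (I := 𝓘(𝕜, 𝕜 × 𝕜)) (G := AffineCover 𝕜) y) 1 = _
  rw [key, key]
  exact (h _ _).trans (lieBracket_eq x y)

/-- The exponential map `(x₁, x₂) ↦ (x₁, x₂ (e^{x₁} - 1) / x₁)` in coordinates, on the open set
where `(e^{x₁} - 1) / x₁` does not vanish. Over `ℂ` this leaves out `x₁ ∈ 2πiℤ`, `x₁ ≠ 0`, where the
exponential map is not injective. -/
def expChartProd : OpenPartialHomeomorph (𝕜 × 𝕜) (𝕜 × 𝕜) where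
  toFun x := (x.1, x.2 * expQuot x.1)
  invFun x := (x.1, x.2 / expQuot x.1)
  source := {x | expQuot x.1 ≠ 0}
  target := {x | expQuot x.1 ≠ 0}
  map_source' _ hx := hx
  map_target' _ hx := hx
  left_inv' x hx := Prod.ext rfl (mul_div_cancel_right₀ _ hx)
  right_inv' x hx := Prod.ext rfl (div_mul_cancel₀ _ hx)
  open_source := isOpen_ne_fun (contDiff_expQuot.continuous.comp continuous_fst) continuous_const
  open_target := isOpen_ne_fun (contDiff_expQuot.continuous.comp continuous_fst) continuous_const
  continuousOn_toFun := by
    have := (contDiff_expQuot (𝕜 := 𝕜)).continuous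
    fun_prop
  continuousOn_invFun := by
    have := (contDiff_expQuot (𝕜 := 𝕜)).continuous
    have h : ∀ x ∈ {x : 𝕜 × 𝕜 | expQuot x.1 ≠ 0}, expQuot x.1 ≠ 0 := fun _ hx => hx
    fun_prop (disch := assumption)

/-- The chart `expChartProd`, from the Lie algebra of `AffineCover` to the group. -/
def expChart : OpenPartialHomeomorph (LieAlg 𝕜 (𝕜 × 𝕜) (AffineCover 𝕜)) (AffineCover 𝕜) :=
  expChartProd

theorem isLieExp_expChart :
    IsLieExp (expChart : LieAlg 𝕜 (𝕜 × 𝕜) (AffineCover 𝕜) → AffineCover 𝕜) := by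
  refine ⟨Prod.ext rfl (zero_mul _), fun X t => ?_⟩
  obtain ⟨x, rfl⟩ := ofProd.surjective X
  have h : HasDerivAt (fun s : 𝕜 => (s * x.1, s * x.2 * expQuot (s * x.1)))
      (x.1, NormedSpace.exp (t * x.1) * x.2) t := by
    refine HasDerivAt.prodMk ?_ ?_
    · simpa using (hasDerivAt_id' t).mul_const x.1
    · have h := (hasDerivAt_mul_expQuot_mul x.1 t).mul_const x.2
      simpa only [mul_right_comm] using h
  have key := mulInvariantVectorField_eq x (expChart (t • ofProd x))
  have h' := h.hasFDerivAt.hasMFDerivAt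
  have h'' : ContinuousLinearMap.toSpanSingleton 𝕜 (M₁ := 𝕜 × 𝕜)
      (x.1, NormedSpace.exp (t * x.1) * x.2) = ContinuousLinearMap.toSpanSingleton 𝕜
        (mulInvariantVectorField (I := 𝓘(𝕜, 𝕜 × 𝕜)) x (expChart (t • ofProd x))) :=
    congrArg (ContinuousLinearMap.toSpanSingleton 𝕜 (M₁ := 𝕜 × 𝕜)) key.symm
  rw [h''] at h'
  exact h'

theorem isExpChart_expChart : IsExpChart (expChart (𝕜 := 𝕜)) where
  isLieExp := isLieExp_expChart
  zero_mem := by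
    change expQuot (0 : 𝕜) ≠ 0
    simp [expQuot_zero]
  analytic := by
    have h : ContDiff 𝕜 ω fun x : 𝕜 × 𝕜 => (x.1, x.2 * expQuot x.1) := by
      have := contDiff_expQuot (𝕜 := 𝕜)
      fun_prop
    exact h.contMDiff.contMDiffOn
  analytic_symm := by
    have h : ContDiffOn 𝕜 ω (fun x : 𝕜 × 𝕜 => (x.1, x.2 / expQuot x.1))
        {x | expQuot x.1 ≠ 0} :=
      contDiffOn_fst.prodMk (contDiffOn_snd.div
        (contDiff_expQuot.comp contDiff_fst).contDiffOn fun _ hx => hx)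
    exact h.contMDiffOn

theorem expChart_mul (t s : 𝕜) :
    expChart (ofProd (0, s)) * expChart (ofProd (t, 0)) = ((t, s) : 𝕜 × 𝕜) := by
  refine (mul_def _ _).trans (Prod.ext (zero_add t) ?_)
  change s * expQuot 0 + NormedSpace.exp 0 * (0 * expQuot t) = s
  simp [expQuot_zero]

theorem expChart_symm_mul (t s : 𝕜) :
    expChart.symm (expChart (ofProd (0, s)) * expChart (ofProd (t, 0))) =
      ofProd (t, s / expQuot t) := by
  rw [expChart_mul]
  rfl

theorem ofProd_zero : ofProd ((0, 0) : 𝕜 × 𝕜) = 0 := map_zero ofProd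

theorem hasSum_ofProd {ι : Type*} {f : ι → 𝕜 × 𝕜} {p : 𝕜 × 𝕜} :
    HasSum (fun i => ofProd (f i)) (ofProd p) ↔ HasSum f p :=
  ofProd.hasSum'

theorem ad_ofProd_pow_succ (t p q : 𝕜) (n : ℕ) :
    ((LieAlgebra.ad 𝕜 (LieAlg 𝕜 (𝕜 × 𝕜) (AffineCover 𝕜)) (ofProd (t, 0))) ^ (n + 1))
      (ofProd (p, q)) = ofProd (0, t ^ (n + 1) * q) := by
  induction n with
  | zero => simp [bracket_ofProd]
  | succ n ih =>
    rw [pow_succ', Module.End.mul_apply, ih, LieAlgebra.ad_apply, bracket_ofProd]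
    congr 2
    ring

theorem expAd_ofProd_fst (t p q : 𝕜) :
    expAd (ofProd (t, 0)) (ofProd (p, q)) = ofProd (p, NormedSpace.exp t * q) := by
  have h1 : HasSum (fun n : ℕ => if n = 0 then p else 0) p := by
    simpa using hasSum_ite_eq (0 : ℕ) p
  have h2 : HasSum (fun n : ℕ => (n.factorial : 𝕜)⁻¹ • t ^ n * q) (NormedSpace.exp t * q) :=
    (NormedSpace.exp_series_hasSum_exp' (𝕂 := 𝕜) t).mul_right q
  refine HasSum.tsum_eq ?_
  convert hasSum_ofProd.mpr (h1.prodMk h2) using 2 with n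
  cases n with
  | zero => simp
  | succ n =>
    rw [ad_ofProd_pow_succ, ← map_smul]
    simp [mul_assoc]

theorem expAd_ofProd_snd (s p q : 𝕜) :
    expAd (ofProd (0, s)) (ofProd (p, q)) = ofProd (p, q - s * p) := by
  have h : ∀ n : ℕ, ((LieAlgebra.ad 𝕜 (LieAlg 𝕜 (𝕜 × 𝕜) (AffineCover 𝕜)) (ofProd (0, s))) ^
      (n + 2)) (ofProd (p, q)) = 0 := by
    intro n
    rw [pow_add, Module.End.mul_apply]
    simp [pow_two, bracket_ofProd, ofProd_zero]
  unfold expAd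
  rw [tsum_eq_sum (s := Finset.range 2)]
  · rw [Finset.sum_range_succ, Finset.sum_range_one]
    simp only [Nat.factorial, pow_zero, pow_one, Module.End.one_apply, LieAlgebra.ad_apply,
      bracket_ofProd]
    simp [← map_add, mul_comm, sub_eq_add_neg]
  · intro n hn
    obtain ⟨m, rfl⟩ := Nat.exists_eq_add_of_le (not_lt.mp (mt Finset.mem_range.mpr hn))
    rw [add_comm, h, smul_zero]

end AffineCover

/-! ### Values of Lie series on the affine Lie algebra -/

section Evaluation

variable {𝕜 : Type u} [RCLike 𝕜]

open AffineCover

theorem evalLie_genX {L : Type u} [LieRing L] [LieAlgebra 𝕜 L] (X Y : L) :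
    evalLie X Y (genX 𝕜) = X := by
  simp [evalLie, genX]

theorem evalLie_adXY (t s : 𝕜) (n : ℕ) :
    evalLie (ofProd (t, 0)) (ofProd (0, s)) (adXY 𝕜 n) = ofProd (0, t ^ n * s) := by
  induction n with
  | zero => simp [evalLie, adXY, genY]
  | succ n ih =>
    have h : adXY 𝕜 (n + 1) = ⁅genX 𝕜, adXY 𝕜 n⁆ := by
      simp [adXY, pow_succ', Module.End.mul_apply]
    unfold evalLie at ih ⊢
    rw [h, LieHom.map_lie, ih]
    have := evalLie_genX (𝕜 := 𝕜) (ofProd (t, (0 : 𝕜))) (ofProd (0, s))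
    unfold evalLie at this
    rw [this, bracket_ofProd]
    congr 2
    ring

/-- The innermost bracket of the monomial is `⁅(ad X)^a Y, (ad X)^b Y⁆`, a bracket of two multiples
of `e`. -/
theorem evalLie_lieMonomial (t s : 𝕜) (l : List ℕ) (a b : ℕ) :
    evalLie (ofProd (t, 0)) (ofProd (0, s)) (lieMonomial 𝕜 (l ++ [a]) b) = 0 := by
  unfold lieMonomial
  induction l with
  | nil =>
    have ha := evalLie_adXY t s a
    have hb := evalLie_adXY t s b
    unfold evalLie at *
    simp [LieHom.map_lie, ha, hb, bracket_ofProd]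
  | cons i l ih =>
    unfold evalLie at *
    rw [List.cons_append, List.foldr_cons, LieHom.map_lie, ih, lie_zero]

theorem evalLie_higherOrder (t s : 𝕜) {n : ℕ} {P : FreeLie 𝕜} (hP : P ∈ higherOrder 𝕜 n) :
    evalLie (ofProd (t, 0)) (ofProd (0, s)) P = 0 := by
  have h : higherOrder 𝕜 n ≤ LinearMap.ker
      (FreeLieAlgebra.lift 𝕜 ![ofProd (t, (0 : 𝕜)), ofProd (0, s)]).toLinearMap := by
    refine Submodule.span_le.mpr ?_
    rintro _ ⟨l, a, b, -, -, rfl⟩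
    exact evalLie_lieMonomial t s l a b
  exact h hP

theorem IsLieSeries.evalLie_succ {F : ℕ → FreeLie 𝕜} {c : 𝕜} {b : PowerSeries 𝕜}
    (hF : IsLieSeries F c b) (t s : 𝕜) (n : ℕ) :
    evalLie (ofProd (t, 0)) (ofProd (0, s)) (F (n + 1)) =
      ofProd (if n = 0 then c * t else 0, PowerSeries.coeff n b * t ^ n * s) := by
  have h := evalLie_higherOrder t s (hF.2 n)
  have hX := evalLie_genX (𝕜 := 𝕜) (ofProd (t, (0 : 𝕜))) (ofProd (0, s))
  have hY := evalLie_adXY t s n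
  unfold evalLie at *
  rw [map_sub, sub_eq_zero] at h
  rw [h, map_add, map_smul, hY]
  split_ifs with hn
  · rw [map_smul, hX, ← map_smul, ← map_smul, ← map_add]
    simp [mul_assoc]
  · rw [map_zero, ← map_smul, zero_add]
    simp [mul_assoc]

theorem IsLieSeries.hasSum_evalLie {F : ℕ → FreeLie 𝕜} {c : 𝕜} {b : PowerSeries 𝕜}
    (hF : IsLieSeries F c b) {t s : 𝕜} {p : 𝕜 × 𝕜}
    (h : HasSum (fun n => evalLie (ofProd (t, 0)) (ofProd (0, s)) (F n)) (ofProd p)) :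
    p.1 = c * t ∧ HasSum (fun n => PowerSeries.coeff n b * t ^ n * s) p.2 := by
  have h0 : evalLie (ofProd (t, (0 : 𝕜))) (ofProd (0, s)) (F 0) = 0 := by
    rw [hF.1]
    exact map_zero _
  rw [← hasSum_nat_add_iff' 1, Finset.sum_range_one, h0, sub_zero] at h
  simp only [hF.evalLie_succ] at h
  have h' := hasSum_ofProd.mp h
  have h1 : HasSum (fun n => if n = 0 then c * t else 0) p.1 :=
    h'.map (AddMonoidHom.fst 𝕜 𝕜) continuous_fst
  exact ⟨h1.unique (hasSum_ite_eq 0 (c * t)), h'.map (AddMonoidHom.snd 𝕜 𝕜) continuous_snd⟩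

/-! ### The scalar identity -/

/-- The `e`-component of the equation at `X = t h`, `Y = s e`, divided by `s` and multiplied by
`e^t - 1`. -/
theorem IsUniversalSolution.eventually_scalar_identity {FA FB : ℕ → FreeLie 𝕜} {ρ α : 𝕜}
    {β γ : PowerSeries 𝕜} (hsol : IsUniversalSolution FA FB) (hA : IsLieSeries FA ρ β)
    (hB : IsLieSeries FB α γ) :
    ∀ᶠ t in nhds (0 : 𝕜), ∃ b : 𝕜, HasSum (fun n => PowerSeries.coeff n β * t ^ n) b ∧
      (1 - NormedSpace.exp (-1 * t)) * b * (NormedSpace.exp t - 1) =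
        α * t * (NormedSpace.exp t - 1) + t - (NormedSpace.exp t - 1) := by
  obtain ⟨U, A, B, hU, hsum⟩ := hsol (𝕜 × 𝕜) (AffineCover 𝕜) expChart isExpChart_expChart
  -- The equation is only used at one `s ≠ 0` for each `t`, and `s` may depend on `t`.
  have hmem : ∀ᶠ t in nhds (0 : 𝕜), ∃ s : 𝕜, s ≠ 0 ∧ (ofProd (t, 0), ofProd (0, s)) ∈ U := by
    have hc : Continuous fun p : 𝕜 × 𝕜 => (ofProd (p.1, (0 : 𝕜)), ofProd ((0 : 𝕜), p.2)) := by
      fun_prop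
    have h : ∀ᶠ p : 𝕜 × 𝕜 in nhds (0, 0), (ofProd (p.1, 0), ofProd (0, p.2)) ∈ U :=
      hc.continuousAt.eventually (hU.isOpen.mem_nhds hU.zero_mem)
    rw [nhds_prod_eq] at h
    filter_upwards [h.curry] with t ht
    obtain ⟨s, hs, hs'⟩ :=
      ((ht.filter_mono nhdsWithin_le_nhds).and (self_mem_nhdsWithin (s := {0}ᶜ))).exists
    exact ⟨s, hs', hs⟩
  filter_upwards [hmem] with t ht
  obtain ⟨s, hs, hU'⟩ := ht
  obtain ⟨p, hp⟩ := ofProd.surjective (A (ofProd (t, 0), ofProd (0, s)))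
  obtain ⟨q, hq⟩ := ofProd.surjective (B (ofProd (t, 0), ofProd (0, s)))
  obtain ⟨hsA, hsB⟩ := hsum _ _ hU'
  rw [← hp] at hsA
  rw [← hq] at hsB
  obtain ⟨-, hA2⟩ := hA.hasSum_evalLie hsA
  obtain ⟨hB1, -⟩ := hB.hasSum_evalLie hsB
  -- Membership in the domain of the logarithm is exactly the non-vanishing of `(e^t - 1) / t`.
  have ht0 : expQuot t ≠ 0 := by
    have h := hU.mem_target _ _ hU'
    rw [expChart_mul] at h
    exact h
  have heq := hU.equation _ _ hU'
  rw [expChart_symm_mul, ← hp, ← hq, ← map_neg, Prod.neg_mk, neg_zero, expAd_ofProd_fst,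
    expAd_ofProd_snd, ← map_sub, ← map_sub, ← map_sub, ← map_sub, ← map_add] at heq
  have h2 := congrArg Prod.snd (ofProd.injective heq)
  simp only [Prod.snd_sub, Prod.snd_add, sub_zero] at h2
  refine ⟨p.2 / s, ?_, ?_⟩
  · simpa [hs] using hA2.div_const s
  · rw [← mul_expQuot, neg_one_mul]
    rw [hB1] at h2
    field_simp at h2 ⊢
    -- `h2` is cleared of denominators; the goal has `e^t - 1 = t expQuot t` in place of `expQuot t`.
    linear_combination (-t) * h2

end Evaluation

end

end KashiwaraVergne

theorem theorem3p1 {𝕜 : Type u} [RCLike 𝕜]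
    (FA FB : ℕ → KashiwaraVergne.FreeLie 𝕜) (ρ α : 𝕜) (β γ : PowerSeries 𝕜)
    (hA : KashiwaraVergne.IsLieSeries FA ρ β)
    (hB : KashiwaraVergne.IsLieSeries FB α γ)
    (hsol : KashiwaraVergne.IsUniversalSolution FA FB) :
    β = KashiwaraVergne.betaSeries 𝕜 α := by
  have key := hsol.eventually_scalar_identity hA hB
  have hβ : KashiwaraVergne.ConvergesTo β (fun t => ∑' n, PowerSeries.coeff n β * t ^ n) := by
    filter_upwards [key] with t ht
    obtain ⟨b, hb, -⟩ := ht
    exact hb.summable.hasSum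
  have hexp : KashiwaraVergne.ConvergesTo (PowerSeries.exp 𝕜 - 1) _ :=
    KashiwaraVergne.ConvergesTo.exp.sub .one
  have hneg := KashiwaraVergne.ConvergesTo.exp.rescale (-1 : 𝕜)
  have hl := ((KashiwaraVergne.ConvergesTo.one.sub hneg).mul hβ).mul hexp
  have hr := ((((KashiwaraVergne.ConvergesTo.const α).mul .X).mul hexp).add .X).sub hexp
  refine KashiwaraVergne.eq_betaSeries (hl.unique hr ?_)
  filter_upwards [key] with t ht
  obtain ⟨b, hb, h⟩ := ht
  rw [hb.tsum_eq]
  exact h
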